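/- **Setting.** All matrices are over $\mathbb F_2$ and $\operatorname{rs}$ denotes row space. Let $H_X\in\mathbb F_2^{m_X\times n_Q}$, $H_Z\in\mathbb F_2^{m_Z\times n_Q}$ with $H_XH_Z^{T}=0$ be the parity-check matrices of a quantum CSS code, with distances $d_X$ (minimum weight in $\ker H_Z\setminus\operatorname{rs}H_X$) and $d_Z$ (minimum weight in $\ker H_X\setminus\operatorname{rs}H_Z$), and let $h\in\mathbb F_2^{m_c\times n_c}$ be a parity-check matrix of a classical code $\ker h$ with distance $d_c$. Redundant rows are allowed in all of these matrices. A minimum over the empty set is $\infty$. Their homological product code has parity-check matrices $$\tilde H_X=\big(H_X\otimes 1\,\big|\,1\otimes h^{T}\big),\qquad \tilde H_Z=\begin{pmatrix}H_Z\otimes 1&0\\ 1\otimes h&H_X^{T}\otimes 1\end{pmatrix},$$ the two column blocks being the left sector ($n_Qn_c$ qubits) and the right sector ($m_Xm_c$ qubits). Choose unit vectors $\{e_i\}_{i\in I}$ that form a basis of a complement of $\operatorname{rs}H_X^{T}$, and $\{e_j\}_{j\in J}$ that form a basis of a complement of $\operatorname{rs}h^{T}$. The spurious (right-sector) logical qubits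 have $X$-operators $(0\,|\,a\otimes e_j)$ with $H_X^{T}a=0$, $j\in J$, and $Z$-operators $(0\,|\,e_i\otimes b)$ with $h^{T}b=0$, $i\in I$. The *left-sector homological product code* is the CSS subsystem code in which these are gauge operators: with $\mathcal G_X$, $\mathcal G_Z$ the spans of $\operatorname{rs}\tilde H_X$, respectively $\operatorname{rs}\tilde H_Z$, and these gauge operators, a nontrivial logical $X$-operator is an $x\in\ker\tilde H_Z\setminus\mathcal G_X$, and a nontrivial logical $Z$-operator is a $z\in\ker\tilde H_X\setminus\mathcal G_Z$. A nontrivial logical operator is a Pauli operator $(x,z)$ with $x\in\ker\tilde H_Z$, $z\in\ker\tilde H_X$ and not both $x\in\mathcal G_X$ and $z\in\mathcal G_Z$. Let $\tilde d_X,\tilde d_Z,\tilde d$ be the corresponding minimum weights. **Gadgets.** Let $\sigma\in S_{n_c}$ and $w\in \mathrm{GL}_{m_c}(\mathbb F_2)$ with $h\sigma=wh$, and let $U\in S_{n_Q}$ be a permutation matrix, $W\in\mathrm{GL}_{m_X}(\mathbb F_2)$, $W'\in\mathrm{GL}_{m_Z}(\mathbb F_2)$ with $H_XU=WH_X$ and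 $H_ZU^{-T}=W'H_Z$. The inherited gadgets $$\tilde U_c=(1\otimes\sigma)\oplus(1\otimes w^{-T}),\qquad \tilde U_Q=(U\otimes 1)\oplus(W\otimes 1)$$ act on supports of $X$-type Pauli operators (row vectors) by $x\mapsto x\tilde U$ and on supports of $Z$-type Pauli operators by $z\mapsto z\tilde U^{-T}$. **Noise.** A gadget is carried out by a circuit, i.e. a finite sequence of physical permutations of the qubits that do not mix the two sectors and of Clifford gates supported in the right sector, whose total action is that of the gadget; thus the left sector is only permuted. An elementary fault is an arbitrary Pauli error on a single qubit at any time, or an arbitrary Pauli error on the support of a gate immediately after this gate. Errors propagate through the later gates; permutations only move errors and do not spread them. The effective fault distance $d^{\rm eff}_X$ (respectively $d^{\rm eff}_Z$) is the least number of elementary faults that can produce a final error whose $X$-part (respectively $Z$-part) is a nontrivial logical $X$- (respectively $Z$-) operator of the left-sector code, and $d^{\rm eff}$ is the least number that can produce a final error that is a nontrivial logical operator. **Theorem.** Every such circuit for $\tilde U_c$, and every such circuit for $\tilde U_Q$, is distance-preserving: $$d^{\rm eff}_X=\tilde d_X,\qquad d^{\rm eff}_Z=\tilde d_Z,\qquad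 d^{\rm eff}=\tilde d .$$ Moreover $d^{\rm eff}_X\ge d_Xd_c$ and $d^{\rm eff}_Z\ge d_Z$. -/

import Mathlib

open Matrix
open scoped Kronecker

noncomputable section

namespace HomProd

/-- The binary field. -/
abbrev F2 : Type := ZMod 2

/-! ### Row spaces, information sets, classical distance -/

/-- The row space `rs H`, i.e. the set of all `x ᵥ* H`. -/
def rowSpace {m n : Type*} [Fintype m] (H : Matrix m n F2) : Submodule F2 (n → F2) :=
  LinearMap.range H.vecMulLinear

/-- The unit vectors `e_i`, `i ∈ I`, form a basis of a complement of the row space of `H`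
(unit vectors are automatically independent). Equivalently, they represent a basis
of `F2^n / rs H`. -/
def UnitsComplement {m n : Type*} [Fintype m] [DecidableEq n] (H : Matrix m n F2)
    (I : Set n) : Prop :=
  IsCompl (Submodule.span F2 ((fun i => (Pi.single i 1 : n → F2)) '' I)) (rowSpace H)

/-- Distance of the classical code `ker h`: the minimum Hamming weight of a nonzero codeword
(`⊤` if there is none). -/
def classicalDist {m n : Type*} [Fintype n] (h : Matrix m n F2) : ℕ∞ :=
  ⨅ c : {c : n → F2 // h *ᵥ c = 0 ∧ c ≠ 0}, (hammingNorm c.1 : ℕ∞)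

/-! ### Pauli errors and CSS subsystem codes -/

/-- Pauli operators up to phase on a set `Q` of qubits: at each qubit the pair
(X-component, Z-component). The product of operators is addition. -/
abbrev Pauli (Q : Type*) : Type _ := Q → F2 × F2

/-- The support of the `X`-part. -/
def Pauli.x {Q : Type*} (p : Pauli Q) : Q → F2 := fun q => (p q).1

/-- The support of the `Z`-part. -/
def Pauli.z {Q : Type*} (p : Pauli Q) : Q → F2 := fun q => (p q).2

/-- The Pauli operator with given `X`-part and `Z`-part. -/
def Pauli.mk {Q : Type*} (x z : Q → F2) : Pauli Q := fun q => (x q, z q)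

/-- The symplectic form; it vanishes exactly when the two operators commute. -/
def Pauli.symp {Q : Type*} [Fintype Q] (p r : Pauli Q) : F2 :=
  p.x ⬝ᵥ r.z + p.z ⬝ᵥ r.x

/-- A CSS subsystem code on qubits `Q`, given by the parity-check matrices of its stabilizer group
and by the supports of the `X`- and `Z`-type logical operators of the logical qubits that are
designated as gauge qubits. -/
structure CSSSubsystemCode (Q MX MZ : Type*) [Fintype Q] where
  HX : Matrix MX Q F2
  HZ : Matrix MZ Q F2
  gaugeLogX : Set (Q → F2)
  gaugeLogZ : Set (Q → F2)
  comm : HX * HZᵀ = 0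
  gaugeLogX_comm : ∀ x ∈ gaugeLogX, HZ *ᵥ x = 0
  gaugeLogZ_comm : ∀ z ∈ gaugeLogZ, HX *ᵥ z = 0

namespace CSSSubsystemCode

variable {Q MX MZ : Type*} [Fintype Q] [Fintype MX] [Fintype MZ]

/-- The `X`-type part of the gauge group: products of `X`-stabilizers and gauge logical
`X`-operators. -/
def gaugeX (D : CSSSubsystemCode Q MX MZ) : Submodule F2 (Q → F2) :=
  rowSpace D.HX ⊔ Submodule.span F2 D.gaugeLogX

/-- The `Z`-type part of the gauge group. -/
def gaugeZ (D : CSSSubsystemCode Q MX MZ) : Submodule F2 (Q → F2) :=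
  rowSpace D.HZ ⊔ Submodule.span F2 D.gaugeLogZ

/-- `x` is the support of a nontrivial (dressed) logical `X`-operator: it commutes with all
stabilizers and is not in the gauge group. -/
def IsLogicalX (D : CSSSubsystemCode Q MX MZ) (x : Q → F2) : Prop :=
  D.HZ *ᵥ x = 0 ∧ x ∉ D.gaugeX

/-- `z` is the support of a nontrivial (dressed) logical `Z`-operator. -/
def IsLogicalZ (D : CSSSubsystemCode Q MX MZ) (z : Q → F2) : Prop :=
  D.HX *ᵥ z = 0 ∧ z ∉ D.gaugeZ

/-- A general Pauli operator that is a nontrivial (dressed) logical operator. -/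
def IsLogical (D : CSSSubsystemCode Q MX MZ) (p : Pauli Q) : Prop :=
  D.HZ *ᵥ p.x = 0 ∧ D.HX *ᵥ p.z = 0 ∧ ¬(p.x ∈ D.gaugeX ∧ p.z ∈ D.gaugeZ)

/-- The `X`-distance (`⊤` if there is no nontrivial logical operator). -/
def distX (D : CSSSubsystemCode Q MX MZ) : ℕ∞ :=
  ⨅ x : {x : Q → F2 // D.IsLogicalX x}, (hammingNorm x.1 : ℕ∞)

/-- The `Z`-distance. -/
def distZ (D : CSSSubsystemCode Q MX MZ) : ℕ∞ :=
  ⨅ z : {z : Q → F2 // D.IsLogicalZ z}, (hammingNorm z.1 : ℕ∞)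

/-- The distance: least number of qubits on which a nontrivial logical operator acts. -/
def dist (D : CSSSubsystemCode Q MX MZ) : ℕ∞ :=
  ⨅ p : {p : Pauli Q // D.IsLogical p}, (hammingNorm p.1 : ℕ∞)

end CSSSubsystemCode

/-- An ordinary CSS code: no gauge qubits. -/
def cssCode {Q MX MZ : Type*} [Fintype Q] (HX : Matrix MX Q F2) (HZ : Matrix MZ Q F2)
    (hcomm : HX * HZᵀ = 0) : CSSSubsystemCode Q MX MZ where
  HX := HX
  HZ := HZ
  gaugeLogX := ∅
  gaugeLogZ := ∅
  comm := hcomm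
  gaugeLogX_comm := by simp
  gaugeLogZ_comm := by simp

/-! ### The (quantum × classical) homological product -/

section Product

variable {Q MX MZ B S : Type*}

/-- Qubits of the product: the left sector `Q × B` and the right sector `MX × S`. -/
abbrev ProdQubits (Q MX B S : Type*) : Type _ := (Q × B) ⊕ (MX × S)

/-- `(H_X ⊗ 1 | 1 ⊗ hᵀ)` -/
def prodHX [DecidableEq MX] [DecidableEq B] (HX : Matrix MX Q F2) (h : Matrix S B F2) :
    Matrix (MX × B) (ProdQubits Q MX B S) F2 :=
  fromCols (HX ⊗ₖ (1 : Matrix B B F2)) ((1 : Matrix MX MX F2) ⊗ₖ hᵀ)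

/-- The two row blocks `(H_Z ⊗ 1 | 0)` and `(1 ⊗ h | H_Xᵀ ⊗ 1)`. -/
def prodHZ [DecidableEq Q] [DecidableEq B] [DecidableEq S]
    (HX : Matrix MX Q F2) (HZ : Matrix MZ Q F2) (h : Matrix S B F2) :
    Matrix ((MZ × B) ⊕ (Q × S)) (ProdQubits Q MX B S) F2 :=
  fromBlocks (HZ ⊗ₖ (1 : Matrix B B F2)) 0 ((1 : Matrix Q Q F2) ⊗ₖ h)
    (HXᵀ ⊗ₖ (1 : Matrix S S F2))

/-- The vector `(0 | a ⊗ b)`, supported on the right sector. -/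
def rightVec (a : MX → F2) (b : S → F2) : ProdQubits Q MX B S → F2 :=
  Sum.elim 0 (fun q => a q.1 * b q.2)

/-- Canonical right-sector logical `X`-operators `(0 | a ⊗ e_j)`, with `a` a codeword of the
transpose code `ker H_Xᵀ` and `j ∈ J`. -/
def rightLogX [Fintype MX] [DecidableEq S] (HX : Matrix MX Q F2) (J : Set S) :
    Set (ProdQubits Q MX B S → F2) :=
  {v | ∃ a : MX → F2, HXᵀ *ᵥ a = 0 ∧ ∃ j ∈ J, v = rightVec a (Pi.single j 1)}

/-- Canonical right-sector logical `Z`-operators `(0 | e_i ⊗ b)`, with `i ∈ I` and `b` a codeword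
of the transpose code `ker hᵀ`. -/
def rightLogZ [Fintype S] [DecidableEq MX] (h : Matrix S B F2) (I : Set MX) :
    Set (ProdQubits Q MX B S → F2) :=
  {v | ∃ i ∈ I, ∃ b : S → F2, hᵀ *ᵥ b = 0 ∧ v = rightVec (Pi.single i 1) b}

theorem prod_comm [Fintype Q] [Fintype MX] [Fintype B] [Fintype S]
    [DecidableEq Q] [DecidableEq MX] [DecidableEq B] [DecidableEq S]
    (HX : Matrix MX Q F2) (HZ : Matrix MZ Q F2) (h : Matrix S B F2) (hcomm : HX * HZᵀ = 0) :
    prodHX HX h * (prodHZ HX HZ h)ᵀ = 0 := by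
  have key : HX ⊗ₖ hᵀ + HX ⊗ₖ hᵀ = 0 := by
    ext i j
    exact CharTwo.add_self_eq_zero _
  rw [prodHX, prodHZ, fromBlocks_transpose, fromCols_mul_fromBlocks]
  simp only [← kroneckerMap_transpose, transpose_one, transpose_transpose, transpose_zero,
    ← mul_kronecker_mul, hcomm, Matrix.one_mul, Matrix.mul_one, Matrix.mul_zero, add_zero,
    zero_kronecker, key]
  ext i (j | j) <;> rfl

theorem prodHZ_rightVec [Fintype Q] [Fintype MX] [Fintype B] [Fintype S]
    [DecidableEq Q] [DecidableEq MX] [DecidableEq B] [DecidableEq S]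
    (HX : Matrix MX Q F2) (HZ : Matrix MZ Q F2) (h : Matrix S B F2)
    (a : MX → F2) (b : S → F2) (ha : HXᵀ *ᵥ a = 0) :
    prodHZ HX HZ h *ᵥ rightVec a b = 0 := by
  have key : ((HXᵀ ⊗ₖ (1 : Matrix S S F2)) *ᵥ fun q : MX × S => a q.1 * b q.2) = 0 := by
    funext i
    have h0 := congrFun ha i.1
    simp only [mulVec, dotProduct, Pi.zero_apply] at h0
    simp only [mulVec, dotProduct, kroneckerMap_apply, Fintype.sum_prod_type, one_apply,
      mul_ite, mul_one, mul_zero, ite_mul, zero_mul, Finset.sum_ite_eq, Finset.mem_univ, if_true,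
      ← mul_assoc, ← Finset.sum_mul, h0, Pi.zero_apply]
  rw [prodHZ, rightVec, fromBlocks_mulVec]
  simp only [Sum.elim_comp_inl, Sum.elim_comp_inr, mulVec_zero, zero_mulVec, key, add_zero]
  ext (j | j) <;> rfl

theorem prodHX_rightVec [Fintype Q] [Fintype MX] [Fintype B] [Fintype S]
    [DecidableEq MX] [DecidableEq B]
    (HX : Matrix MX Q F2) (h : Matrix S B F2)
    (a : MX → F2) (b : S → F2) (hb : hᵀ *ᵥ b = 0) :
    prodHX HX h *ᵥ rightVec a b = 0 := by
  have key : (((1 : Matrix MX MX F2) ⊗ₖ hᵀ) *ᵥ fun q : MX × S => a q.1 * b q.2) = 0 := by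
    funext i
    have h0 := congrFun hb i.2
    simp only [mulVec, dotProduct, Pi.zero_apply] at h0
    simp only [mulVec, dotProduct, kroneckerMap_apply, Fintype.sum_prod_type, one_apply,
      ite_mul, zero_mul, one_mul, Pi.zero_apply]
    rw [Finset.sum_comm]
    simp only [Finset.sum_ite_eq, Finset.mem_univ, if_true, mul_left_comm _ (a i.1),
      ← Finset.mul_sum, h0, mul_zero]
  rw [prodHX, rightVec, fromCols_mulVec]
  simp only [Sum.elim_comp_inl, Sum.elim_comp_inr, mulVec_zero, key, add_zero]

/-- The left-sector homological product code: the CSS subsystem code obtained from the product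
code by designating the right-sector logical qubits, with canonical logical operators indexed by
`I` and `J`, as gauge qubits. -/
def leftSectorCode [Fintype Q] [Fintype MX] [Fintype B] [Fintype S]
    [DecidableEq Q] [DecidableEq MX] [DecidableEq B] [DecidableEq S]
    (HX : Matrix MX Q F2) (HZ : Matrix MZ Q F2) (hcomm : HX * HZᵀ = 0) (h : Matrix S B F2)
    (I : Set MX) (J : Set S) :
    CSSSubsystemCode (ProdQubits Q MX B S) (MX × B) ((MZ × B) ⊕ (Q × S)) where
  HX := prodHX HX h
  HZ := prodHZ HX HZ h
  gaugeLogX := rightLogX HX J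
  gaugeLogZ := rightLogZ h I
  comm := prod_comm HX HZ h hcomm
  gaugeLogX_comm := by
    rintro x ⟨a, ha, j, -, rfl⟩
    exact prodHZ_rightVec HX HZ h a _ ha
  gaugeLogZ_comm := by
    rintro z ⟨i, -, b, hb, rfl⟩
    exact prodHX_rightVec HX h _ b hb

/-- The gadget `Ũ_c = (1 ⊗ σ) ⊕ (1 ⊗ w^{-T})` inherited from the classical code. -/
def gadgetC [DecidableEq Q] [DecidableEq MX] [Fintype S] [DecidableEq S]
    (σ : Matrix B B F2) (w : GL S F2) :
    Matrix (ProdQubits Q MX B S) (ProdQubits Q MX B S) F2 :=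
  fromBlocks ((1 : Matrix Q Q F2) ⊗ₖ σ) 0 0
    ((1 : Matrix MX MX F2) ⊗ₖ ((w⁻¹ : GL S F2) : Matrix S S F2)ᵀ)

/-- The gadget `Ũ_Q = (U ⊗ 1) ⊕ (W ⊗ 1)` inherited from the quantum code. -/
def gadgetQ [DecidableEq B] [DecidableEq S] [Fintype MX] [DecidableEq MX]
    (U : Matrix Q Q F2) (W : GL MX F2) :
    Matrix (ProdQubits Q MX B S) (ProdQubits Q MX B S) F2 :=
  fromBlocks (U ⊗ₖ (1 : Matrix B B F2)) 0 0
    ((W : Matrix MX MX F2) ⊗ₖ (1 : Matrix S S F2))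

end Product

/-! ### Circuits, elementary faults and the effective fault distance -/

section Circuits

variable {Q MX MZ : Type*} [Fintype Q] [DecidableEq Q]

/-- The action of `U` on Pauli operators: supports of `X`-type operators are row vectors that are
multiplied by `U`, supports of `Z`-type operators are multiplied by `U^{-T}`. -/
def pauliAction (U : Matrix Q Q F2) (p : Pauli Q) : Pauli Q :=
  Pauli.mk (p.x ᵥ* U) (p.z ᵥ* (U⁻¹)ᵀ)

/-- A Clifford gate, given by its (symplectic) conjugation action on Pauli operators. It acts
only on the qubits of `support`. -/
structure CliffordGate (Q : Type*) [Fintype Q] where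
  support : Finset Q
  act : Pauli Q ≃ₗ[F2] Pauli Q
  symp_act : ∀ p r, (act p).symp (act r) = p.symp r
  act_off : ∀ p, ∀ q ∉ support, act p q = p q

/-- A step of a circuit: a physical permutation of the qubits (the qubit at `q` is moved to
`π q`), or a gate. -/
inductive Step (Q : Type*) [Fintype Q]
  | perm (π : Equiv.Perm Q)
  | gate (g : CliffordGate Q)

/-- A circuit is a sequence of steps; the head of the list is executed first. -/
abbrev Circuit (Q : Type*) [Fintype Q] : Type _ := List (Step Q)

/-- Propagation of a Pauli error through a step. A permutation only moves the errors. -/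
def Step.act : Step Q → Pauli Q → Pauli Q
  | .perm π, p => fun q => p (π.symm q)
  | .gate g, p => g.act p

/-- Propagation of a Pauli error through a circuit. -/
def Circuit.act : Circuit Q → Pauli Q → Pauli Q
  | [], p => p
  | s :: C, p => Circuit.act C (s.act p)

/-- `FaultyRun C e k e'`: if `C` is started with the Pauli error `e` on the qubits, then `k`
elementary faults can lead to the Pauli error `e'` at the end of `C`. An elementary fault is
either an arbitrary Pauli error on a single qubit, at any time (a failure of an idling location
or of a single-qubit operation), or an arbitrary Pauli error on the support of a gate, after that
gate. A permutation step produces no correlated error. -/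
inductive FaultyRun : Circuit Q → Pauli Q → ℕ → Pauli Q → Prop
  | done (e : Pauli Q) : FaultyRun [] e 0 e
  | idleFault {C : Circuit Q} {e f e' : Pauli Q} {k : ℕ} (q : Q) (hf : ∀ r, r ≠ q → f r = 0)
      (hrun : FaultyRun C (e + f) k e') : FaultyRun C e (k + 1) e'
  | step {C : Circuit Q} {e e' : Pauli Q} {k : ℕ} (s : Step Q)
      (hrun : FaultyRun C (s.act e) k e') : FaultyRun (s :: C) e k e'
  | gateFault {C : Circuit Q} {e f e' : Pauli Q} {k : ℕ} (g : CliffordGate Q)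
      (hf : ∀ r ∉ g.support, f r = 0)
      (hrun : FaultyRun C (g.act e + f) k e') : FaultyRun (.gate g :: C) e (k + 1) e'

variable [Fintype MX] [Fintype MZ]

/-- Effective `X` fault distance: the least number of elementary faults in `C` after which the
`X`-part of the error is a nontrivial logical `X`-operator. -/
def faultDistX (D : CSSSubsystemCode Q MX MZ) (C : Circuit Q) : ℕ∞ :=
  ⨅ k : {k : ℕ // ∃ e, FaultyRun C 0 k e ∧ D.IsLogicalX e.x}, (k.1 : ℕ∞)

/-- Effective `Z` fault distance. -/
def faultDistZ (D : CSSSubsystemCode Q MX MZ) (C : Circuit Q) : ℕ∞ :=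
  ⨅ k : {k : ℕ // ∃ e, FaultyRun C 0 k e ∧ D.IsLogicalZ e.z}, (k.1 : ℕ∞)

/-- Effective fault distance: the least number of elementary faults in `C` that effect a
nontrivial logical operator of any type. -/
def faultDist (D : CSSSubsystemCode Q MX MZ) (C : Circuit Q) : ℕ∞ :=
  ⨅ k : {k : ℕ // ∃ e, FaultyRun C 0 k e ∧ D.IsLogical e}, (k.1 : ℕ∞)

/-- The circuit is distance-preserving: its effective fault distances are the distances of the
code. -/
def IsDistancePreserving (D : CSSSubsystemCode Q MX MZ) (C : Circuit Q) : Prop :=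
  faultDistX D C = D.distX ∧ faultDistZ D C = D.distZ ∧ faultDist D C = D.dist

end Circuits

/-- The circuit `C` realizes the transformation `U` of a two-sector code, acting on the left
sector `L` by physical permutations only: all gates are in the right sector, and the physical
permutations do not mix the sectors. -/
structure Realizes {L R : Type*} [Fintype L] [Fintype R] [DecidableEq L] [DecidableEq R]
    (C : Circuit (L ⊕ R)) (U : Matrix (L ⊕ R) (L ⊕ R) F2) : Prop where
  act_eq : ∀ p, Circuit.act C p = pauliAction U p
  perm_left : ∀ π, Step.perm π ∈ C → ∀ q, (π q).isLeft = q.isLeft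
  gate_right : ∀ g, Step.gate g ∈ C → ∀ q ∈ g.support, q.isRight

end HomProd

end

open HomProd

/-!
The bounds hold because correlated faults cannot touch the left sector, and because the left
sector alone already carries the full weight of a nontrivial logical operator of the code.

*Circuits.* All gates are supported in the right sector and permutations do not mix the sectors,
so every elementary fault adds at most one to the number of left-sector qubits that carry an error
(`FaultyRun.leftWeight_le`). Conversely, a Pauli error of weight `k` is produced by `k` single-qubit
faults after the last step (`FaultyRun.of_hammingNorm`). Hence the fault distances agree with the
code distances as soon as the left-sector part of every nontrivial logical operator has at least
the weight of some nontrivial logical operator of the same type.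

*Codes.* Vectors on the two sectors are written as pairs of matrices `(X | R)`, which turns the
parity checks into the matrix equations `H_Z X = 0`, `X hᵀ = H_Xᵀ R` (`X`-type operators) and
`H_X X = R h` (`Z`-type operators).

If `(X | R)` is an `X`-type operator commuting with all stabilizers and is not a gauge operator,
then some `ℓ` in `ker H_X` has `ℓ X ≠ 0` (`exists_separating_of_notMem_gaugeX`). As
`ℓ X hᵀ = ℓ H_Xᵀ R = 0`, the vector `ℓ X` is a codeword of `ker h`, so at least `d_c` of its
entries are nonzero; in each such column `X` is a vector of `ker H_Z` outside `rs H_X`, hence of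
weight at least `d_X`. So `X` has weight at least `d_X d_c`, and this is the weight of the logical
operator `(x cᵀ | 0)` formed from minimizers `x` and `c`.

If `(X | R)` is a `Z`-type operator commuting with all stabilizers and is not a gauge operator, then
some codeword `c` of `ker h` has `X c ∉ rs H_Z` (`exists_codeword_of_notMem_gaugeZ`). As
`H_X X c = R h c = 0`, the vector `X c` is a nontrivial logical operator of the CSS code, and it is
supported on the nonzero rows of `X`, so `X` has weight at least `d_Z`. This is attained by
`(z e_bᵀ | 0)` with `z` a minimizer and `b` in the support of `c`.

Both existence statements use generalized inverses, together with the fact that the unit vectors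
`e_i` and `e_j` of the gauge operators span the whole space modulo the image of the check matrix
(`UnitsComplement.exists_rightInverse_off`); that is what makes the remaining right-sector part a
gauge operator.
-/

namespace HomProd

/-! ### Vectors on the two sectors as pairs of matrices -/

section Sectors

variable {Q MX MZ B S : Type*}

/-- The vector `(X | R)` on the qubits of the product code, with the left-sector part and the
right-sector part given as matrices. -/
def sectors (X : Matrix Q B F2) (R : Matrix MX S F2) : ProdQubits Q MX B S → F2 :=
  Sum.elim (fun q => X q.1 q.2) (fun q => R q.1 q.2)

theorem exists_eq_sectors (v : ProdQubits Q MX B S → F2) :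
    ∃ (X : Matrix Q B F2) (R : Matrix MX S F2), v = sectors X R :=
  ⟨of fun q b => v (.inl (q, b)), of fun a s => v (.inr (a, s)), by ext (q | q) <;> rfl⟩

theorem sectors_add (X X' : Matrix Q B F2) (R R' : Matrix MX S F2) :
    sectors (X + X') (R + R') = sectors X R + sectors X' R' := by
  ext (q | q) <;> rfl

theorem kronecker_mulVec_matrix {l m n p : Type*} [Fintype m] [Fintype p]
    (M : Matrix l m F2) (N : Matrix n p F2) (X : Matrix m p F2) :
    ((M ⊗ₖ N) *ᵥ fun q => X q.1 q.2) = fun q => (M * X * Nᵀ) q.1 q.2 := by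
  funext q
  simp only [mulVec, dotProduct, kroneckerMap_apply, Fintype.sum_prod_type, mul_apply,
    transpose_apply, Finset.sum_mul]
  rw [Finset.sum_comm]
  exact Finset.sum_congr rfl fun _ _ => Finset.sum_congr rfl fun _ _ => by ring

/-- Over the binary field the matrix equation `M + N = 0` says `M = N`. -/
theorem matrix_eq_of_add_eq_zero {m n : Type*} {M N : Matrix m n F2} (hMN : M + N = 0) :
    M = N := by
  ext i j
  exact CharTwo.add_eq_zero.1 (congrFun (congrFun hMN i) j)

theorem prodHX_mulVec_sectors [Fintype Q] [Fintype MX] [Fintype B] [Fintype S]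
    [DecidableEq MX] [DecidableEq B] (HX : Matrix MX Q F2) (h : Matrix S B F2)
    (X : Matrix Q B F2) (R : Matrix MX S F2) :
    prodHX HX h *ᵥ sectors X R = fun q => (HX * X + R * h) q.1 q.2 := by
  rw [prodHX, sectors, fromCols_mulVec]
  simp only [Sum.elim_comp_inl, Sum.elim_comp_inr, kronecker_mulVec_matrix, transpose_one,
    transpose_transpose, Matrix.mul_one, Matrix.one_mul]
  rfl

theorem prodHX_mulVec_sectors_eq_zero [Fintype Q] [Fintype MX] [Fintype B] [Fintype S]
    [DecidableEq MX] [DecidableEq B] {HX : Matrix MX Q F2} {h : Matrix S B F2}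
    {X : Matrix Q B F2} {R : Matrix MX S F2} :
    prodHX HX h *ᵥ sectors X R = 0 ↔ HX * X = R * h := by
  rw [prodHX_mulVec_sectors]
  refine ⟨fun H => matrix_eq_of_add_eq_zero ?_, fun H => ?_⟩
  · ext i j
    exact congrFun H (i, j)
  · funext q
    rw [H]
    exact CharTwo.add_self_eq_zero _

theorem prodHZ_mulVec_sectors_eq_zero [Fintype Q] [Fintype MX] [Fintype B] [Fintype S]
    [DecidableEq Q] [DecidableEq B] [DecidableEq S]
    {HX : Matrix MX Q F2} {HZ : Matrix MZ Q F2} {h : Matrix S B F2}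
    {X : Matrix Q B F2} {R : Matrix MX S F2} :
    prodHZ HX HZ h *ᵥ sectors X R = 0 ↔ HZ * X = 0 ∧ X * hᵀ = HXᵀ * R := by
  rw [prodHZ, sectors, fromBlocks_mulVec]
  simp only [Sum.elim_comp_inl, Sum.elim_comp_inr, kronecker_mulVec_matrix, transpose_one,
    Matrix.mul_one, Matrix.one_mul, zero_mulVec, add_zero]
  refine ⟨fun H => ⟨?_, matrix_eq_of_add_eq_zero ?_⟩, fun ⟨H1, H2⟩ => ?_⟩
  · ext i j
    exact congrFun H (.inl (i, j))
  · ext i j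
    exact congrFun H (.inr (i, j))
  · rw [H1, H2]
    ext (q | q)
    · rfl
    · exact CharTwo.add_self_eq_zero _

theorem mem_rowSpace {m n : Type*} [Fintype m] {H : Matrix m n F2} {x : n → F2} :
    x ∈ rowSpace H ↔ ∃ y, y ᵥ* H = x :=
  Iff.rfl

theorem vecMul_prodHX [Fintype MX] [Fintype B] [DecidableEq MX] [DecidableEq B]
    (HX : Matrix MX Q F2) (h : Matrix S B F2) (A : Matrix MX B F2) :
    (fun q => A q.1 q.2) ᵥ* prodHX HX h = sectors (HXᵀ * A) (A * hᵀ) := by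
  rw [← mulVec_transpose, prodHX, transpose_fromCols, fromRows_mulVec]
  simp only [← kroneckerMap_transpose, kronecker_mulVec_matrix, transpose_one,
    transpose_transpose, Matrix.mul_one, Matrix.one_mul]
  rfl

theorem vecMul_prodHZ [Fintype Q] [Fintype MZ] [Fintype B] [Fintype S]
    [DecidableEq Q] [DecidableEq B] [DecidableEq S]
    (HX : Matrix MX Q F2) (HZ : Matrix MZ Q F2) (h : Matrix S B F2)
    (A : Matrix MZ B F2) (C : Matrix Q S F2) :
    Sum.elim (fun q => A q.1 q.2) (fun q => C q.1 q.2) ᵥ* prodHZ HX HZ h =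
      sectors (HZᵀ * A + C * h) (HX * C) := by
  rw [← mulVec_transpose, prodHZ, fromBlocks_transpose, fromBlocks_mulVec]
  simp only [Sum.elim_comp_inl, Sum.elim_comp_inr, ← kroneckerMap_transpose,
    kronecker_mulVec_matrix, transpose_one, transpose_zero, transpose_transpose, Matrix.mul_one,
    Matrix.one_mul, zero_mulVec, zero_add]
  rfl

end Sectors

/-! ### Generalized inverses and unit vectors modulo an image -/

section Inverses

theorem exists_generalizedInverse {m n : Type*} [Fintype m] [Fintype n] (M : Matrix m n F2) :
    ∃ N : Matrix n m F2, M * N * M = M := by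
  classical
  obtain ⟨g, hg⟩ := M.mulVecLin.rangeRestrict.exists_rightInverse_of_surjective
    (LinearMap.range_rangeRestrict _)
  obtain ⟨g', hg'⟩ := LinearMap.exists_extend g
  refine ⟨LinearMap.toMatrix' g', ?_⟩
  apply Matrix.ext_of_mulVec_single
  intro j
  set v : n → F2 := Pi.single j 1
  have h1 : g' (M *ᵥ v) = g (M.mulVecLin.rangeRestrict v) :=
    LinearMap.congr_fun hg' (M.mulVecLin.rangeRestrict v)
  have h2 := congrArg Subtype.val (LinearMap.congr_fun hg (M.mulVecLin.rangeRestrict v))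
  rw [← mulVec_mulVec, ← mulVec_mulVec, LinearMap.toMatrix'_mulVec, h1]
  exact h2

/-- If the unit vectors `e_j`, `j ∈ J`, span a complement of the image of `M`, then `M` has a
right inverse up to errors in the rows in `J`. -/
theorem UnitsComplement.exists_rightInverse_off {m n : Type*} [Fintype n] [DecidableEq m]
    {M : Matrix m n F2} {J : Set m} (hJ : UnitsComplement Mᵀ J) :
    ∃ N : Matrix n m F2, ∀ j ∉ J, ∀ s, (M * N) j s = (1 : Matrix m m F2) j s := by
  have key : ∀ s : m, ∃ y : n → F2, ∀ j ∉ J, (M *ᵥ y) j = (1 : Matrix m m F2) j s := by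
    intro s
    have hs : (Pi.single s 1 : m → F2) ∈
        Submodule.span F2 ((fun i => (Pi.single i 1 : m → F2)) '' J) ⊔ rowSpace Mᵀ := by
      rw [hJ.sup_eq_top]
      trivial
    obtain ⟨u, hu, v, hv, huv⟩ := Submodule.mem_sup.1 hs
    obtain ⟨y, rfl⟩ := mem_rowSpace.1 hv
    refine ⟨y, fun j hj => ?_⟩
    have hu0 : u j = 0 := by
      have hle : Submodule.span F2 ((fun i => (Pi.single i 1 : m → F2)) '' J) ≤
          LinearMap.ker (LinearMap.proj j : (m → F2) →ₗ[F2] F2) := by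
        rw [Submodule.span_le]
        rintro _ ⟨i, hi, rfl⟩
        exact Pi.single_eq_of_ne (fun hji : j = i => hj (hji ▸ hi)) _
      exact hle hu
    have := congrFun huv j
    rw [Pi.add_apply, hu0, zero_add, vecMul_transpose] at this
    rw [this, one_apply, Pi.single_apply]
  choose N hN using key
  exact ⟨of fun b s => N s b, fun j hj s => hN s j hj⟩

end Inverses

/-! ### Hamming weights and the input CSS code -/

section Weights

variable {Q MX MZ B S : Type*} [Fintype Q] [Fintype B]

theorem hammingNorm_matrix_eq_sum_columns (X : Matrix Q B F2) :
    hammingNorm (fun q : Q × B => X q.1 q.2) = ∑ b, hammingNorm fun q => X q b := by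
  simp only [hammingNorm, Finset.card_filter, Fintype.sum_prod_type]
  exact Finset.sum_comm

theorem hammingNorm_sectors_vecMulVec [Fintype MX] [Fintype S] (x : Q → F2) (c : B → F2) :
    hammingNorm (sectors (vecMulVec x c) 0 : ProdQubits Q MX B S → F2) =
      hammingNorm x * hammingNorm c := by
  classical
  rw [hammingNorm, hammingNorm, hammingNorm, ← Finset.card_product]
  refine (Finset.card_bij (fun q _ => .inl q) ?_ (fun _ _ _ _ => Sum.inl.inj) ?_).symm
  · intro q hq
    refine Finset.mem_filter.2 ⟨Finset.mem_univ _, ?_⟩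
    simpa [sectors, vecMulVec_apply] using hq
  · rintro (q | q) hq
    · have := (Finset.mem_filter.1 hq).2
      exact ⟨q, by simpa [sectors, vecMulVec_apply] using this, rfl⟩
    · exact absurd rfl (Finset.mem_filter.1 hq).2

theorem hammingNorm_mulVec_le (X : Matrix Q B F2) (c : B → F2) :
    hammingNorm (X *ᵥ c) ≤ hammingNorm (fun q : Q × B => X q.1 q.2) := by
  classical
  refine le_trans (Finset.card_le_card fun q hq => ?_) (Finset.card_image_le (f := Prod.fst))
  simp only [Finset.mem_filter, Finset.mem_univ, true_and, mulVec, dotProduct] at hq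
  obtain ⟨b, -, hb⟩ := Finset.exists_ne_zero_of_sum_ne_zero hq
  exact Finset.mem_image.2 ⟨(q, b), by simpa using left_ne_zero_of_mul hb, rfl⟩

end Weights

section InputCode

variable {Q MX MZ : Type*} [Fintype Q] {HX : Matrix MX Q F2} {HZ : Matrix MZ Q F2}
  {hcomm : HX * HZᵀ = 0}

theorem gaugeX_cssCode [Fintype MX] : (cssCode HX HZ hcomm).gaugeX = rowSpace HX := by
  simp [CSSSubsystemCode.gaugeX, cssCode]

theorem gaugeZ_cssCode [Fintype MZ] : (cssCode HX HZ hcomm).gaugeZ = rowSpace HZ := by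
  simp [CSSSubsystemCode.gaugeZ, cssCode]

theorem isLogicalX_cssCode [Fintype MX] {x : Q → F2} :
    (cssCode HX HZ hcomm).IsLogicalX x ↔ HZ *ᵥ x = 0 ∧ x ∉ rowSpace HX := by
  rw [CSSSubsystemCode.IsLogicalX, gaugeX_cssCode]
  rfl

theorem isLogicalZ_cssCode [Fintype MZ] {z : Q → F2} :
    (cssCode HX HZ hcomm).IsLogicalZ z ↔ HX *ᵥ z = 0 ∧ z ∉ rowSpace HZ := by
  rw [CSSSubsystemCode.IsLogicalZ, gaugeZ_cssCode]
  rfl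

end InputCode

/-! ### Gauge operators and nontrivial logical operators of the left-sector code -/

section Code

variable {Q MX MZ B S : Type*} [Fintype Q] [Fintype MX] [Fintype B] [Fintype S]
  [DecidableEq Q] [DecidableEq MX] [DecidableEq B] [DecidableEq S]
  {HX : Matrix MX Q F2} {HZ : Matrix MZ Q F2} {hcomm : HX * HZᵀ = 0} {h : Matrix S B F2}
  {I : Set MX} {J : Set S}

theorem sectors_mem_gaugeX_of_stabilizer (A : Matrix MX B F2) :
    sectors (HXᵀ * A) (A * hᵀ) ∈ (leftSectorCode HX HZ hcomm h I J).gaugeX :=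
  Submodule.mem_sup_left ⟨_, vecMul_prodHX HX h A⟩

theorem sectors_mem_gaugeZ_of_stabilizer [Fintype MZ] (A : Matrix MZ B F2) (C : Matrix Q S F2) :
    sectors (HZᵀ * A + C * h) (HX * C) ∈ (leftSectorCode HX HZ hcomm h I J).gaugeZ :=
  Submodule.mem_sup_left ⟨_, vecMul_prodHZ HX HZ h A C⟩

theorem sectors_zero_mem_gaugeX {E : Matrix MX S F2} (hE : HXᵀ * E = 0)
    (hEJ : ∀ a, ∀ j ∉ J, E a j = 0) :
    sectors 0 E ∈ (leftSectorCode HX HZ hcomm h I J).gaugeX := by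
  have hsum : (sectors 0 E : ProdQubits Q MX B S → F2) =
      ∑ j, rightVec (fun a => E a j) (Pi.single j 1) := by
    ext (q | q)
    · simp [sectors, rightVec]
    · simp [sectors, rightVec, Pi.single_apply]
  rw [hsum]
  refine Submodule.mem_sup_right (Submodule.sum_mem _ fun j _ => ?_)
  by_cases hj : j ∈ J
  · refine Submodule.subset_span ⟨_, ?_, j, hj, rfl⟩
    funext q
    exact congrFun (congrFun hE q) j
  · convert Submodule.zero_mem _
    ext (q | q)
    · rfl
    · simp [rightVec, hEJ _ j hj]

theorem sectors_zero_mem_gaugeZ [Fintype MZ] {E : Matrix MX S F2} (hE : E * h = 0)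
    (hEI : ∀ i ∉ I, ∀ s, E i s = 0) :
    sectors 0 E ∈ (leftSectorCode HX HZ hcomm h I J).gaugeZ := by
  have hsum : (sectors 0 E : ProdQubits Q MX B S → F2) =
      ∑ i, rightVec (Pi.single i 1) (E i) := by
    ext (q | q)
    · simp [sectors, rightVec]
    · simp [sectors, rightVec, Pi.single_apply]
  rw [hsum]
  refine Submodule.mem_sup_right (Submodule.sum_mem _ fun i _ => ?_)
  by_cases hi : i ∈ I
  · refine Submodule.subset_span ⟨i, hi, _, ?_, rfl⟩
    rw [mulVec_transpose]
    exact congrFun hE i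
  · convert Submodule.zero_mem _
    ext (q | q)
    · rfl
    · simp [rightVec, hEI i hi]

/-- The left-sector part of a nontrivial logical `X`-operator has nonzero product with some element
of `ker H_X`. -/
theorem exists_separating_of_notMem_gaugeX (hJ : UnitsComplement hᵀ J)
    {X : Matrix Q B F2} {R : Matrix MX S F2} (hXR : X * hᵀ = HXᵀ * R)
    (hg : sectors X R ∉ (leftSectorCode HX HZ hcomm h I J).gaugeX) :
    ∃ l : Q → F2, l ᵥ* HXᵀ = 0 ∧ l ᵥ* X ≠ 0 := by
  obtain ⟨G, hG⟩ := exists_generalizedInverse HXᵀ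
  obtain ⟨N, hN⟩ := hJ.exists_rightInverse_off
  by_contra! hno
  apply hg
  -- The rows of `1 - H_Xᵀ G` lie in `ker H_X`, so `X` lies in the image of `H_Xᵀ`.
  have hX : X = HXᵀ * (G * X) := by
    have h0 : (1 - HXᵀ * G) * X = 0 := by
      ext q b
      refine congrFun (hno ((1 - HXᵀ * G : Matrix Q Q F2) q) ?_) b
      funext a
      have : (1 - HXᵀ * G) * HXᵀ = 0 := by
        rw [Matrix.sub_mul, hG, Matrix.one_mul, sub_self]
      exact congrFun (congrFun this q) a
    rw [Matrix.sub_mul, Matrix.one_mul, sub_eq_zero, Matrix.mul_assoc] at h0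
    exact h0
  -- Up to the stabilizer formed from `A` only a right-sector part `R'` is left. Its columns lie in
  -- `ker H_Xᵀ`, and `R' Nᵀ hᵀ` agrees with it in the columns outside of `J`.
  set A := G * X
  set R' := R - A * hᵀ with hR'
  have hR'0 : HXᵀ * R' = 0 := by
    rw [hR', Matrix.mul_sub, ← hXR, ← Matrix.mul_assoc, ← hX, sub_self]
  have hdecomp : sectors X R = sectors (HXᵀ * A) (A * hᵀ) +
      (sectors (HXᵀ * (R' * Nᵀ)) (R' * Nᵀ * hᵀ) + sectors 0 (R' - R' * Nᵀ * hᵀ)) := by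
    rw [← sectors_add, ← sectors_add, ← hX, ← Matrix.mul_assoc HXᵀ R', hR'0, Matrix.zero_mul,
      add_zero, add_zero, add_sub_cancel, hR', add_sub_cancel]
  rw [hdecomp]
  refine Submodule.add_mem _ (sectors_mem_gaugeX_of_stabilizer _)
    (Submodule.add_mem _ (sectors_mem_gaugeX_of_stabilizer _) (sectors_zero_mem_gaugeX ?_ ?_))
  · rw [Matrix.mul_sub, Matrix.mul_assoc R', ← Matrix.mul_assoc HXᵀ R', hR'0, Matrix.zero_mul,
      sub_zero]
  · intro a j hj
    have : (R' * (h * N)ᵀ) a j = R' a j := by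
      rw [mul_apply]
      simp only [transpose_apply, hN j hj, one_apply, mul_ite, mul_one, mul_zero,
        Finset.sum_ite_eq, Finset.mem_univ, if_true]
    rw [Matrix.sub_apply, Matrix.mul_assoc, ← transpose_mul, this, sub_self]

/-- The left-sector part of a nontrivial logical `Z`-operator maps some codeword of `ker h` outside
of the row space of `H_Z`. -/
theorem exists_codeword_of_notMem_gaugeZ [Fintype MZ] (hI : UnitsComplement HXᵀ I)
    {X : Matrix Q B F2} {R : Matrix MX S F2} (hXR : HX * X = R * h)
    (hg : sectors X R ∉ (leftSectorCode HX HZ hcomm h I J).gaugeZ) :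
    ∃ c : B → F2, h *ᵥ c = 0 ∧ X *ᵥ c ∉ rowSpace HZ := by
  obtain ⟨G, hG⟩ := exists_generalizedInverse h
  obtain ⟨N, hN⟩ := hI.exists_rightInverse_off
  by_contra! hno
  apply hg
  -- The columns of `1 - G h` are codewords, so those of `X (1 - G h)` lie in `rs H_Z`.
  have hA : ∃ A : Matrix MZ B F2, HZᵀ * A = X - X * G * h := by
    have hcol : ∀ b, ∃ y : MZ → F2, HZᵀ *ᵥ y = fun q => (X - X * G * h) q b := by
      intro b
      have hmem := hno (fun b' => (1 - G * h : Matrix B B F2) b' b) (by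
        have : h * (1 - G * h) = 0 := by
          rw [Matrix.mul_sub, ← Matrix.mul_assoc, hG, Matrix.mul_one, sub_self]
        funext s
        exact congrFun (congrFun this s) b)
      obtain ⟨y, hy⟩ := mem_rowSpace.1 hmem
      refine ⟨y, ?_⟩
      rw [mulVec_transpose, hy, Matrix.mul_assoc]
      funext q
      have : X - X * (G * h) = X * (1 - G * h) := by rw [Matrix.mul_sub, Matrix.mul_one]
      rw [this]
      rfl
    choose y hy using hcol
    exact ⟨of fun a b => y b a, by
      ext q b
      exact congrFun (hy b) q⟩
  obtain ⟨A, hA⟩ := hA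
  -- Up to a stabilizer only a right-sector part `R'` is left. Its rows lie in `ker hᵀ`,
  -- and `H_X N R'` agrees with it in the rows outside of `I`.
  set R' := R - HX * (X * G) with hR'
  have hR'0 : R' * h = 0 := by
    have hXA : HX * (X - X * G * h) = 0 := by
      rw [← hA, ← Matrix.mul_assoc, hcomm, Matrix.zero_mul]
    rw [hR', Matrix.sub_mul, ← hXR, Matrix.mul_assoc HX, ← Matrix.mul_sub, hXA]
  have hdecomp : sectors X R = sectors (HZᵀ * A + X * G * h) (HX * (X * G)) +
      (sectors
        (HZᵀ * (0 : Matrix MZ B F2) + N * R' * h) (HX * (N * R'))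
        + sectors 0 (R' - HX * (N * R'))) := by
    rw [← sectors_add, ← sectors_add, hA, Matrix.mul_assoc N, hR'0, Matrix.mul_zero,
      Matrix.mul_zero, add_zero, add_zero, add_zero, sub_add_cancel, add_sub_cancel, hR',
      add_sub_cancel]
  rw [hdecomp]
  refine Submodule.add_mem _ (sectors_mem_gaugeZ_of_stabilizer _ _)
    (Submodule.add_mem _ (sectors_mem_gaugeZ_of_stabilizer _ _) (sectors_zero_mem_gaugeZ ?_ ?_))
  · rw [Matrix.sub_mul, Matrix.mul_assoc HX, Matrix.mul_assoc N, hR'0, Matrix.mul_zero,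
      Matrix.mul_zero, sub_zero]
  · intro i hi s
    have : (HX * N * R') i s = R' i s := by
      rw [mul_apply]
      simp only [hN i hi, one_apply, ite_mul, one_mul, zero_mul, Finset.sum_ite_eq,
        Finset.mem_univ, if_true]
    rw [Matrix.sub_apply, ← Matrix.mul_assoc, this, sub_self]

/-- In matrix form `(X | R)`, an `X`-type gauge operator has all columns of `X` in `rs H_X`. -/
theorem column_mem_rowSpace_of_mem_gaugeX {v : ProdQubits Q MX B S → F2}
    (hv : v ∈ (leftSectorCode HX HZ hcomm h I J).gaugeX) (b : B) :
    (fun q => v (.inl (q, b))) ∈ rowSpace HX := by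
  let f : (ProdQubits Q MX B S → F2) →ₗ[F2] (Q → F2) :=
    LinearMap.funLeft F2 F2 fun q => Sum.inl (q, b)
  have hle : (leftSectorCode HX HZ hcomm h I J).gaugeX ≤ (rowSpace HX).comap f := by
    refine sup_le ?_ (Submodule.span_le.2 ?_)
    · rintro _ ⟨y, rfl⟩
      refine ⟨fun a => y (a, b), ?_⟩
      have := vecMul_prodHX HX h (of fun a b => y (a, b))
      funext q
      refine Eq.trans ?_ (congrFun this (.inl (q, b))).symm
      rw [vecMulLinear_apply, ← mulVec_transpose]
      rfl
    · rintro _ ⟨a, -, j, -, rfl⟩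
      change (0 : Q → F2) ∈ rowSpace HX
      exact Submodule.zero_mem _
  exact hle hv

/-- In matrix form `(X | R)`, a `Z`-type gauge operator maps codewords of `ker h` into `rs H_Z`:
the left-sector part of a stabilizer is `H_Zᵀ A + C h`, and the second term kills codewords. -/
theorem mulVec_mem_rowSpace_of_mem_gaugeZ [Fintype MZ] {v : ProdQubits Q MX B S → F2}
    (hv : v ∈ (leftSectorCode HX HZ hcomm h I J).gaugeZ) {c : B → F2} (hc : h *ᵥ c = 0) :
    (of fun q b => v (.inl (q, b)) : Matrix Q B F2) *ᵥ c ∈ rowSpace HZ := by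
  let f : (ProdQubits Q MX B S → F2) →ₗ[F2] (Q → F2) :=
    { toFun := fun v => (of fun q b => v (.inl (q, b)) : Matrix Q B F2) *ᵥ c
      map_add' := fun u v => by rw [← add_mulVec]; rfl
      map_smul' := fun r v => by rw [RingHom.id_apply, ← smul_mulVec]; rfl }
  have hle : (leftSectorCode HX HZ hcomm h I J).gaugeZ ≤ (rowSpace HZ).comap f := by
    refine sup_le ?_ (Submodule.span_le.2 ?_)
    · rintro _ ⟨y, rfl⟩
      let A : Matrix MZ B F2 := of fun a b => y (.inl (a, b))
      let C : Matrix Q S F2 := of fun q s => y (.inr (q, s))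
      have hy : y = Sum.elim (fun q => A q.1 q.2) (fun q => C q.1 q.2) := by
        ext (q | q) <;> rfl
      have h1 : y ᵥ* prodHZ HX HZ h = sectors (HZᵀ * A + C * h) (HX * C) := by
        rw [hy]
        exact vecMul_prodHZ HX HZ h A C
      refine ⟨A *ᵥ c, ?_⟩
      change (A *ᵥ c) ᵥ* HZ =
        (of fun q b => (y ᵥ* prodHZ HX HZ h) (.inl (q, b)) : Matrix Q B F2) *ᵥ c
      rw [h1, ← mulVec_transpose, mulVec_mulVec]
      change _ = (HZᵀ * A + C * h) *ᵥ c
      rw [add_mulVec, ← mulVec_mulVec c C h, hc, mulVec_zero, add_zero]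
    · rintro _ ⟨i, -, b, -, rfl⟩
      change (0 : Matrix Q B F2) *ᵥ c ∈ rowSpace HZ
      rw [zero_mulVec]
      exact Submodule.zero_mem _
  exact hle hv

/-! ### Distances and left-sector weights -/

theorem isLogicalX_sectors_vecMulVec {x : Q → F2} {c : B → F2}
    (hx : (cssCode HX HZ hcomm).IsLogicalX x) (hc : h *ᵥ c = 0) (hc0 : c ≠ 0) :
    (leftSectorCode HX HZ hcomm h I J).IsLogicalX (sectors (vecMulVec x c) 0) := by
  rw [isLogicalX_cssCode] at hx
  refine ⟨prodHZ_mulVec_sectors_eq_zero.2 ⟨?_, ?_⟩, fun hg => ?_⟩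
  · rw [mul_vecMulVec, hx.1, zero_vecMulVec]
  · rw [vecMulVec_mul, vecMul_transpose, hc, Matrix.mul_zero]
    ext q s
    exact mul_zero _
  · obtain ⟨b, hb⟩ := Function.ne_iff.1 hc0
    have hb1 : c b = 1 := Fin.eq_one_of_ne_zero _ hb
    have := column_mem_rowSpace_of_mem_gaugeX hg b
    simp only [sectors, Sum.elim_inl, vecMulVec_apply, hb1, mul_one] at this
    exact hx.2 this

theorem isLogicalZ_sectors_vecMulVec [Fintype MZ] {z : Q → F2} {c : B → F2} {b : B}
    (hz : (cssCode HX HZ hcomm).IsLogicalZ z) (hc : h *ᵥ c = 0) (hb : c b = 1) :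
    (leftSectorCode HX HZ hcomm h I J).IsLogicalZ
      (sectors (vecMulVec z (Pi.single b 1)) 0) := by
  rw [isLogicalZ_cssCode] at hz
  refine ⟨prodHX_mulVec_sectors_eq_zero.2 ?_, fun hg => ?_⟩
  · rw [mul_vecMulVec, hz.1, zero_vecMulVec, Matrix.zero_mul]
  · have := mulVec_mem_rowSpace_of_mem_gaugeZ hg hc
    change vecMulVec z (Pi.single b 1) *ᵥ c ∈ _ at this
    rw [vecMulVec_mulVec, single_one_dotProduct, hb] at this
    exact hz.2 (by simpa using this)

/-- The left-sector part of a nontrivial logical `X`-operator has weight at least `d_X d_c`, and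
the `X`-distance of the code is at most `d_X d_c` if there is such an operator. -/
theorem distX_le_and_mul_le_leftWeight (hJ : UnitsComplement hᵀ J)
    {v : ProdQubits Q MX B S → F2} (hv : (leftSectorCode HX HZ hcomm h I J).IsLogicalX v) :
    (leftSectorCode HX HZ hcomm h I J).distX ≤
        (cssCode HX HZ hcomm).distX * classicalDist h ∧
      (cssCode HX HZ hcomm).distX * classicalDist h ≤ hammingNorm (v ∘ Sum.inl) := by
  obtain ⟨X, R, rfl⟩ := exists_eq_sectors v
  obtain ⟨hker, hg⟩ := hv
  obtain ⟨hZX, hXR⟩ := prodHZ_mulVec_sectors_eq_zero.1 hker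
  obtain ⟨l, hl, hlX⟩ := exists_separating_of_notMem_gaugeX hJ hXR hg
  have hcode : h *ᵥ (l ᵥ* X) = 0 := by
    rw [← vecMul_transpose, vecMul_vecMul, hXR, ← vecMul_vecMul, hl, zero_vecMul]
  have hcol : ∀ b, (l ᵥ* X) b ≠ 0 →
      (cssCode HX HZ hcomm).IsLogicalX fun q => X q b := by
    intro b hb
    refine isLogicalX_cssCode.2 ⟨?_, fun hmem => hb ?_⟩
    · funext a
      exact congrFun (congrFun hZX a) b
    · obtain ⟨y, hy⟩ := mem_rowSpace.1 hmem
      change l ⬝ᵥ (fun q => X q b) = 0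
      rw [← hy, ← mulVec_transpose, dotProduct_mulVec, hl, zero_dotProduct]
  constructor
  · obtain ⟨b, hb⟩ := Function.ne_iff.1 hlX
    have : Nonempty {x : Q → F2 // (cssCode HX HZ hcomm).IsLogicalX x} := ⟨⟨_, hcol b hb⟩⟩
    have : Nonempty {c : B → F2 // h *ᵥ c = 0 ∧ c ≠ 0} := ⟨⟨_, hcode, hlX⟩⟩
    obtain ⟨x, hx⟩ := ENat.exists_eq_iInf
      fun x : {x : Q → F2 // (cssCode HX HZ hcomm).IsLogicalX x} => (hammingNorm x.1 : ℕ∞)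
    obtain ⟨c, hc⟩ := ENat.exists_eq_iInf
      fun c : {c : B → F2 // h *ᵥ c = 0 ∧ c ≠ 0} => (hammingNorm c.1 : ℕ∞)
    rw [CSSSubsystemCode.distX, CSSSubsystemCode.distX, classicalDist, ← hx, ← hc,
      ← Nat.cast_mul, ← hammingNorm_sectors_vecMulVec (MX := MX) (S := S)]
    exact iInf_le (fun v : {v // (leftSectorCode HX HZ hcomm h I J).IsLogicalX v} =>
      (hammingNorm v.1 : ℕ∞)) ⟨_, isLogicalX_sectors_vecMulVec x.2 c.2.1 c.2.2⟩
  · have hcard : classicalDist h ≤ (hammingNorm (l ᵥ* X) : ℕ∞) :=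
      iInf_le (fun c : {c : B → F2 // h *ᵥ c = 0 ∧ c ≠ 0} => (hammingNorm c.1 : ℕ∞))
        ⟨_, hcode, hlX⟩
    have hwt : ∀ b ∈ Finset.univ.filter (fun b => (l ᵥ* X) b ≠ 0),
        (cssCode HX HZ hcomm).distX ≤ (hammingNorm (fun q => X q b) : ℕ∞) := fun b hb =>
      iInf_le (fun x : {x : Q → F2 // (cssCode HX HZ hcomm).IsLogicalX x} =>
        (hammingNorm x.1 : ℕ∞)) ⟨_, hcol b (Finset.mem_filter.1 hb).2⟩
    calc (cssCode HX HZ hcomm).distX * classicalDist h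
        ≤ (cssCode HX HZ hcomm).distX * (hammingNorm (l ᵥ* X) : ℕ∞) := by gcongr
      _ = ∑ b with (l ᵥ* X) b ≠ 0, (cssCode HX HZ hcomm).distX := by
          rw [Finset.sum_const, nsmul_eq_mul, mul_comm]
          rfl
      _ ≤ ∑ b with (l ᵥ* X) b ≠ 0, (hammingNorm (fun q => X q b) : ℕ∞) :=
          Finset.sum_le_sum hwt
      _ ≤ ∑ b, (hammingNorm (fun q => X q b) : ℕ∞) :=
          Finset.sum_le_sum_of_subset (Finset.filter_subset _ _)
      _ = hammingNorm (fun q : Q × B => X q.1 q.2) := by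
          rw [hammingNorm_matrix_eq_sum_columns, Nat.cast_sum]

/-- The left-sector part of a nontrivial logical `Z`-operator has weight at least `d_Z`, and the
`Z`-distance of the code is at most `d_Z` if there is such an operator. -/
theorem distZ_le_and_le_leftWeight [Fintype MZ] (hI : UnitsComplement HXᵀ I)
    {v : ProdQubits Q MX B S → F2} (hv : (leftSectorCode HX HZ hcomm h I J).IsLogicalZ v) :
    (leftSectorCode HX HZ hcomm h I J).distZ ≤ (cssCode HX HZ hcomm).distZ ∧
      (cssCode HX HZ hcomm).distZ ≤ hammingNorm (v ∘ Sum.inl) := by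
  obtain ⟨X, R, rfl⟩ := exists_eq_sectors v
  obtain ⟨hker, hg⟩ := hv
  have hXR := prodHX_mulVec_sectors_eq_zero.1 hker
  obtain ⟨c, hc, hXc⟩ := exists_codeword_of_notMem_gaugeZ hI hXR hg
  constructor
  · have hc0 : c ≠ 0 := by
      rintro rfl
      exact hXc ((mulVec_zero X).symm ▸ Submodule.zero_mem _)
    obtain ⟨b, hb⟩ := Function.ne_iff.1 hc0
    have hb1 : c b = 1 := Fin.eq_one_of_ne_zero _ hb
    refine le_iInf fun z => ?_
    refine (iInf_le (fun v : {v // (leftSectorCode HX HZ hcomm h I J).IsLogicalZ v} =>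
      (hammingNorm v.1 : ℕ∞)) ⟨_, isLogicalZ_sectors_vecMulVec z.2 hc hb1⟩).trans ?_
    have hone : hammingNorm (Pi.single b 1 : B → F2) = 1 := by
      simp [hammingNorm, Pi.single_apply, Finset.filter_eq']
    rw [hammingNorm_sectors_vecMulVec, hone, mul_one]
  · have hlog : (cssCode HX HZ hcomm).IsLogicalZ (X *ᵥ c) := by
      refine isLogicalZ_cssCode.2 ⟨?_, hXc⟩
      rw [mulVec_mulVec, hXR, ← mulVec_mulVec, hc, mulVec_zero]
    refine (iInf_le (fun z : {z : Q → F2 // (cssCode HX HZ hcomm).IsLogicalZ z} =>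
      (hammingNorm z.1 : ℕ∞)) ⟨_, hlog⟩).trans ?_
    exact Nat.cast_le.2 (hammingNorm_mulVec_le X c)

end Code

/-! ### Propagation of faults -/

section Faults

theorem hammingNorm_x_le {Q : Type*} [Fintype Q] (p : Pauli Q) :
    hammingNorm p.x ≤ hammingNorm p :=
  hammingNorm_comp_le_hammingNorm (fun _ => Prod.fst) fun _ => rfl

theorem hammingNorm_z_le {Q : Type*} [Fintype Q] (p : Pauli Q) :
    hammingNorm p.z ≤ hammingNorm p :=
  hammingNorm_comp_le_hammingNorm (fun _ => Prod.snd) fun _ => rfl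

theorem Step.act_zero {Q : Type*} [Fintype Q] (s : Step Q) : s.act 0 = 0 := by
  cases s with
  | perm π => rfl
  | gate g => exact map_zero g.act

theorem FaultyRun.append_of_zero {Q : Type*} [Fintype Q] [DecidableEq Q] {e : Pauli Q} {k : ℕ}
    (he : FaultyRun [] 0 k e) (C : Circuit Q) : FaultyRun C 0 k e := by
  induction C with
  | nil => exact he
  | cons s C ih => exact .step s (by rwa [Step.act_zero])

/-- Any Pauli error is produced by as many single-qubit faults as its weight. -/
theorem FaultyRun.of_hammingNorm {Q : Type*} [Fintype Q] [DecidableEq Q] (C : Circuit Q)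
    (e : Pauli Q) : FaultyRun C 0 (hammingNorm e) e := by
  refine append_of_zero ?_ C
  -- At the end of the circuit the error is corrected to `e` on one qubit of `T` after the other.
  have key : ∀ (T : Finset Q) (e' : Pauli Q), (∀ q ∉ T, e' q = e q) →
      FaultyRun [] e' T.card e := by
    intro T
    induction T using Finset.induction_on with
    | empty =>
      intro e' he'
      rw [show e' = e from funext fun q => he' q (Finset.notMem_empty q)]
      exact .done e
    | insert q T hq ih =>
      intro e' he'
      rw [Finset.card_insert_of_notMem hq]
      refine .idleFault (f := Pi.single q (e q - e' q)) q
        (fun r hr => Pi.single_eq_of_ne hr _) (ih _ fun r hr => ?_)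
      by_cases hrq : r = q
      · subst hrq
        simp
      · simp [hrq, he' r (by simp [hrq, hr])]
  exact key (Finset.univ.filter fun q => e q ≠ 0) 0 fun q hq => by
    simpa [eq_comm] using hq

theorem leftWeight_add_le {L R : Type*} [Fintype L] (e f : Pauli (L ⊕ R)) (q : L ⊕ R)
    (hf : ∀ r, r ≠ q → f r = 0) :
    hammingNorm ((e + f) ∘ Sum.inl) ≤ hammingNorm (e ∘ Sum.inl) + 1 := by
  refine le_trans (b := hammingNorm (e ∘ Sum.inl) + hammingNorm (f ∘ Sum.inl)) ?_ ?_
  · change hammingNorm (e ∘ Sum.inl + f ∘ Sum.inl) ≤ _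
    have := hammingDist_triangle (-(e ∘ Sum.inl)) 0 (f ∘ Sum.inl)
    simpa [hammingDist_eq_hammingNorm] using this
  · gcongr
    refine Finset.card_le_one.2 fun a ha b hb => ?_
    simp only [Finset.mem_filter, Finset.mem_univ, true_and, Function.comp_apply] at ha hb
    have ha' := not_imp_comm.1 (hf (.inl a)) ha
    have hb' := not_imp_comm.1 (hf (.inl b)) hb
    exact Sum.inl_injective (ha'.trans hb'.symm)

variable {L R : Type*} [Fintype L] [Fintype R]

/-- A step that never spreads errors into or within the left sector `L`: a permutation that does not
mix the sectors, or a gate supported in the right sector. -/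
def Step.PreservesLeft : Step (L ⊕ R) → Prop
  | .perm π => ∀ q, (π q).isLeft = q.isLeft
  | .gate g => ∀ q ∈ g.support, q.isRight

theorem CliffordGate.inl_notMem_support {g : CliffordGate (L ⊕ R)}
    (hg : ∀ q ∈ g.support, q.isRight) (l : L) : Sum.inl l ∉ g.support :=
  fun hl => by simpa using hg _ hl

theorem Step.PreservesLeft.leftWeight_act_le {s : Step (L ⊕ R)} (hs : s.PreservesLeft)
    (e : Pauli (L ⊕ R)) :
    hammingNorm (s.act e ∘ Sum.inl) ≤ hammingNorm (e ∘ Sum.inl) := by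
  cases s with
  | gate g =>
    have : (Step.gate g).act e ∘ Sum.inl = e ∘ Sum.inl :=
      funext fun l => g.act_off e _ (CliffordGate.inl_notMem_support hs l)
    rw [this]
  | perm π =>
    have hleft : ∀ l : L, ∃ l' : L, π.symm (.inl l) = .inl l' := fun l => by
      have := hs (π.symm (.inl l))
      rw [Equiv.apply_symm_apply] at this
      exact Sum.isLeft_iff.1 this.symm
    choose ρ hρ using hleft
    have hinj : Function.Injective ρ := fun a b hab =>
      Sum.inl_injective (π.symm.injective (by rw [hρ, hρ, hab]))
    refine Finset.card_le_card_of_injOn ρ (fun l hl => ?_) hinj.injOn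
    simpa [Step.act, hρ] using hl

/-- If all gates act in the right sector and the sectors are not mixed, then `k` elementary faults
raise the weight of the error in the left sector by at most `k`. -/
theorem FaultyRun.leftWeight_le [DecidableEq L] [DecidableEq R]
    {C : Circuit (L ⊕ R)} {e e' : Pauli (L ⊕ R)} {k : ℕ}
    (hrun : FaultyRun C e k e') (hC : ∀ s ∈ C, s.PreservesLeft) :
    hammingNorm (e' ∘ Sum.inl) ≤ hammingNorm (e ∘ Sum.inl) + k := by
  induction hrun with
  | done e => exact le_rfl
  | @idleFault C e f e' k q hf hrun ih =>
    have := ih hC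
    have := leftWeight_add_le e f q hf
    omega
  | @step C e e' k s hrun ih =>
    have := ih fun t ht => hC t (List.mem_cons_of_mem _ ht)
    have := (hC s List.mem_cons_self).leftWeight_act_le e
    omega
  | @gateFault C e f e' k g hf hrun ih =>
    have := ih fun t ht => hC t (List.mem_cons_of_mem _ ht)
    have hg : (Step.gate g).PreservesLeft := hC _ List.mem_cons_self
    have hadd : (g.act e + f) ∘ Sum.inl = e ∘ Sum.inl := funext fun l => by
      have hl := CliffordGate.inl_notMem_support hg l
      change g.act e (.inl l) + f (.inl l) = e (.inl l)
      rw [g.act_off e _ hl, hf _ hl, add_zero]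
    rw [hadd] at this
    omega

theorem Realizes.preservesLeft [DecidableEq L] [DecidableEq R]
    {C : Circuit (L ⊕ R)} {U : Matrix (L ⊕ R) (L ⊕ R) F2}
    (hC : Realizes C U) : ∀ s ∈ C, s.PreservesLeft := by
  rintro (π | g) hs
  · exact hC.perm_left π hs
  · exact hC.gate_right g hs

theorem FaultyRun.leftWeight_x_le [DecidableEq L] [DecidableEq R]
    {C : Circuit (L ⊕ R)} {e : Pauli (L ⊕ R)} {k : ℕ}
    (hrun : FaultyRun C 0 k e) (hC : ∀ s ∈ C, s.PreservesLeft) :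
    hammingNorm (e.x ∘ Sum.inl) ≤ k := by
  have h0 : hammingNorm ((0 : Pauli (L ⊕ R)) ∘ Sum.inl) = 0 := hammingNorm_zero
  have h1 := hrun.leftWeight_le hC
  have h2 := hammingNorm_x_le (e ∘ Sum.inl)
  rw [h0, zero_add] at h1
  exact h2.trans h1

theorem FaultyRun.leftWeight_z_le [DecidableEq L] [DecidableEq R]
    {C : Circuit (L ⊕ R)} {e : Pauli (L ⊕ R)} {k : ℕ}
    (hrun : FaultyRun C 0 k e) (hC : ∀ s ∈ C, s.PreservesLeft) :
    hammingNorm (e.z ∘ Sum.inl) ≤ k := by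
  have h0 : hammingNorm ((0 : Pauli (L ⊕ R)) ∘ Sum.inl) = 0 := hammingNorm_zero
  have h1 := hrun.leftWeight_le hC
  have h2 := hammingNorm_z_le (e ∘ Sum.inl)
  rw [h0, zero_add] at h1
  exact h2.trans h1

end Faults

/-! ### Fault distances and code distances -/

section FaultDistance

variable {Q MX MZ : Type*} [Fintype Q]

theorem hammingNorm_mk_zero_right (x : Q → F2) : hammingNorm (Pauli.mk x 0) = hammingNorm x := by
  simp [hammingNorm, Pauli.mk, Prod.ext_iff]

theorem hammingNorm_mk_zero_left (z : Q → F2) : hammingNorm (Pauli.mk 0 z) = hammingNorm z := by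
  simp [hammingNorm, Pauli.mk, Prod.ext_iff]

theorem faultDistX_le_distX [DecidableEq Q] [Fintype MX]
    (D : CSSSubsystemCode Q MX MZ) (C : Circuit Q) :
    faultDistX D C ≤ D.distX := by
  refine le_iInf fun x => ?_
  rw [← hammingNorm_mk_zero_right]
  exact iInf_le (fun k : {k : ℕ // ∃ e, FaultyRun C 0 k e ∧ D.IsLogicalX e.x} => (k.1 : ℕ∞))
    ⟨_, _, FaultyRun.of_hammingNorm C (Pauli.mk x.1 0), x.2⟩

theorem faultDistZ_le_distZ [DecidableEq Q] [Fintype MZ]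
    (D : CSSSubsystemCode Q MX MZ) (C : Circuit Q) :
    faultDistZ D C ≤ D.distZ := by
  refine le_iInf fun z => ?_
  rw [← hammingNorm_mk_zero_left]
  exact iInf_le (fun k : {k : ℕ // ∃ e, FaultyRun C 0 k e ∧ D.IsLogicalZ e.z} => (k.1 : ℕ∞))
    ⟨_, _, FaultyRun.of_hammingNorm C (Pauli.mk 0 z.1), z.2⟩

theorem faultDist_le_dist [DecidableEq Q] [Fintype MX] [Fintype MZ]
    (D : CSSSubsystemCode Q MX MZ) (C : Circuit Q) :
    faultDist D C ≤ D.dist :=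
  le_iInf fun p =>
    iInf_le (fun k : {k : ℕ // ∃ e, FaultyRun C 0 k e ∧ D.IsLogical e} => (k.1 : ℕ∞))
      ⟨_, _, FaultyRun.of_hammingNorm C p.1, p.2⟩

theorem CSSSubsystemCode.dist_le_distX [Fintype MX] [Fintype MZ]
    (D : CSSSubsystemCode Q MX MZ) : D.dist ≤ D.distX := by
  refine le_iInf fun x => ?_
  rw [← hammingNorm_mk_zero_right]
  exact iInf_le (fun p : {p : Pauli Q // D.IsLogical p} => (hammingNorm p.1 : ℕ∞))
    ⟨Pauli.mk x.1 0, x.2.1, mulVec_zero _, fun hg => x.2.2 hg.1⟩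

theorem CSSSubsystemCode.dist_le_distZ [Fintype MX] [Fintype MZ]
    (D : CSSSubsystemCode Q MX MZ) : D.dist ≤ D.distZ := by
  refine le_iInf fun z => ?_
  rw [← hammingNorm_mk_zero_left]
  exact iInf_le (fun p : {p : Pauli Q // D.IsLogical p} => (hammingNorm p.1 : ℕ∞))
    ⟨Pauli.mk 0 z.1, mulVec_zero _, z.2.1, fun hg => z.2.2 hg.2⟩

theorem CSSSubsystemCode.IsLogical.isLogicalX_or_isLogicalZ [Fintype MX] [Fintype MZ]
    {D : CSSSubsystemCode Q MX MZ}
    {p : Pauli Q} (hp : D.IsLogical p) : D.IsLogicalX p.x ∨ D.IsLogicalZ p.z := by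
  by_cases hx : p.x ∈ D.gaugeX
  · exact .inr ⟨hp.2.1, fun hz => hp.2.2 ⟨hx, hz⟩⟩
  · exact .inl ⟨hp.1, hx⟩

end FaultDistance

end HomProd

theorem mainTheorem8
    {Q MX MZ B S : Type*} [Fintype Q] [Fintype MX] [Fintype MZ] [Fintype B] [Fintype S]
    [DecidableEq Q] [DecidableEq MX] [DecidableEq MZ] [DecidableEq B] [DecidableEq S]
    -- the input CSS code and the input classical code (redundant checks are allowed)
    (HX : Matrix MX Q F2) (HZ : Matrix MZ Q F2) (hcomm : HX * HZᵀ = 0) (h : Matrix S B F2)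
    -- a choice of canonical logical operators for the right-sector (gauge) logical qubits
    (I : Set MX) (hI : UnitsComplement HXᵀ I) (J : Set S) (hJ : UnitsComplement hᵀ J)
    -- the input gadget of the CSS code is a code automorphism
    (τ : Equiv.Perm Q) (W : GL MX F2) (W' : GL MZ F2)
    (hX : HX * τ.permMatrix F2 = (W : Matrix MX MX F2) * HX)
    (hZ : HZ * ((τ.permMatrix F2)⁻¹)ᵀ = (W' : Matrix MZ MZ F2) * HZ)
    -- an automorphism of the classical code
    (σ : Equiv.Perm B) (w : GL S F2)
    (hσ : h * σ.permMatrix F2 = (w : Matrix S S F2) * h)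
    -- any realization of one of the two inherited gadgets with free permutations
    (C : Circuit (ProdQubits Q MX B S))
    (hC : Realizes C (gadgetC (σ.permMatrix F2) w) ∨ Realizes C (gadgetQ (τ.permMatrix F2) W)) :
    IsDistancePreserving (leftSectorCode HX HZ hcomm h I J) C ∧
    (cssCode HX HZ hcomm).distX * classicalDist h ≤
      faultDistX (leftSectorCode HX HZ hcomm h I J) C ∧
    (cssCode HX HZ hcomm).distZ ≤ faultDistZ (leftSectorCode HX HZ hcomm h I J) C := by
  have hleft : ∀ s ∈ C, s.PreservesLeft := hC.elim Realizes.preservesLeft Realizes.preservesLeft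
  refine ⟨⟨(faultDistX_le_distX _ _).antisymm (le_iInf ?_),
    (faultDistZ_le_distZ _ _).antisymm (le_iInf ?_),
    (faultDist_le_dist _ _).antisymm (le_iInf ?_)⟩, le_iInf ?_, le_iInf ?_⟩
  · rintro ⟨k, e, hrun, he⟩
    obtain ⟨h1, h2⟩ := distX_le_and_mul_le_leftWeight hJ he
    exact h1.trans (h2.trans (Nat.cast_le.2 (hrun.leftWeight_x_le hleft)))
  · rintro ⟨k, e, hrun, he⟩
    obtain ⟨h1, h2⟩ := distZ_le_and_le_leftWeight hI he
    exact h1.trans (h2.trans (Nat.cast_le.2 (hrun.leftWeight_z_le hleft)))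
  · rintro ⟨k, e, hrun, he⟩
    rcases he.isLogicalX_or_isLogicalZ with he | he
    · obtain ⟨h1, h2⟩ := distX_le_and_mul_le_leftWeight hJ he
      exact (CSSSubsystemCode.dist_le_distX _).trans
        (h1.trans (h2.trans (Nat.cast_le.2 (hrun.leftWeight_x_le hleft))))
    · obtain ⟨h1, h2⟩ := distZ_le_and_le_leftWeight hI he
      exact (CSSSubsystemCode.dist_le_distZ _).trans
        (h1.trans (h2.trans (Nat.cast_le.2 (hrun.leftWeight_z_le hleft))))
  · rintro ⟨k, e, hrun, he⟩
    exact (distX_le_and_mul_le_leftWeight hJ he).2.trans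
      (Nat.cast_le.2 (hrun.leftWeight_x_le hleft))
  · rintro ⟨k, e, hrun, he⟩
    exact (distZ_le_and_le_leftWeight hI he).2.trans
      (Nat.cast_le.2 (hrun.leftWeight_z_le hleft))
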